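/- A \emph{cycle set} is a nonempty set $X$ with a binary operation $\cdot$ such that every left multiplication $\sigma_x : y\mapsto x\cdot y$ is bijective and $(x\cdot y)\cdot(x\cdot z)=(y\cdot x)\cdot(y\cdot z)$ for all $x,y,z\in X$. Its \emph{permutation group} $\mathcal G(X)$ is the subgroup of $\mathrm{Sym}(X)$ generated by all $\sigma_x$. It is \emph{indecomposable} if there is no partition $X=Y\sqcup Z$ into two nonempty subsets with $\sigma_x(Y)\subseteq Y$ and $\sigma_x(Z)\subseteq Z$ for all $x\in X$. Let $p$ and $q$ be prime numbers, not necessarily distinct. The indecomposable cycle sets of order $pq$ with abelian permutation group are, up to isomorphism, exactly the following. \textbf{Case $p\neq q$.} There is exactly one: $\mathbb Z/pq\mathbb Z$ with $i\cdot j=j+1$. Its permutation group is isomorphic to $(\mathbb Z/pq\mathbb Z,+)$. \textbf{Case $p=q$.} There are exactly $p+1$; the following cycle sets form a complete list and are pairwise non-isomorphic: (a) $\mathbb Z/p^2\mathbb Z$ with $i\cdot j=j+1$; its permutation group is isomorphic to $(\mathbb Z/p^2\mathbb Z,+)$. (b) $\mathbb Z/p^2\mathbb Z$ with $i\cdot j=j+1+p\,f(i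 \bmod p)$, where $f:\mathbb Z/p\mathbb Z\to\{0,\dots,p-1\}$ is a bijection with $f(0)=0$ and $f(i+1)+f(j)\equiv f(i)+f(j+1)\pmod p$ for all $i,j\in\mathbb Z/p\mathbb Z$; equivalently, there is a nonzero $t\in\mathbb Z/p\mathbb Z$ such that $f(k)$ is the representative of $kt$ in $\{0,\dots,p-1\}$ for every $k$. There are $p-1$ such functions $f$, different $f$ give non-isomorphic cycle sets, and the permutation group is isomorphic to $(\mathbb Z/p^2\mathbb Z,+)$ in each case. (c) $\mathbb Z/p\mathbb Z\times\mathbb Z/p\mathbb Z$ with $(i,s)\cdot(j,t)=(j+1,t+i)$; its permutation group is isomorphic to $(\mathbb Z/p\mathbb Z\times\mathbb Z/p\mathbb Z,+)$. -/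

import Mathlib

/-- A cycle set: a nonempty set with a binary operation `x · y` all of whose left multiplications
are invertible and which satisfies `(x · y) · (x · z) = (y · x) · (y · z)`. -/
structure CycleSet (X : Type*) where
  op : X → X → X
  nonempty : Nonempty X
  bijective_op : ∀ x, Function.Bijective (op x)
  cycle : ∀ x y z, op (op x y) (op x z) = op (op y x) (op y z)

namespace CycleSet

/-- The left multiplication `σ_x : y ↦ x · y`, as a permutation. -/
noncomputable def sigma {X : Type*} (S : CycleSet X) (x : X) : Equiv.Perm X :=
  Equiv.ofBijective (S.op x) (S.bijective_op x)

/-- The permutation group `𝒢(X)`, generated by all left multiplications. -/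
def permGroup {X : Type*} (S : CycleSet X) : Subgroup (Equiv.Perm X) :=
  Subgroup.closure (Set.range S.sigma)

/-- `Y ⊆ X` is `𝒢(X)`-invariant when `σ_x(Y) ⊆ Y` for all `x`. -/
def IsInvariant {X : Type*} (S : CycleSet X) (Y : Set X) : Prop :=
  ∀ x, S.sigma x '' Y ⊆ Y

/-- There is a partition `{Y, Z}` of `X` into two invariant (nonempty) subsets. -/
def Decomposable {X : Type*} (S : CycleSet X) : Prop :=
  ∃ Y Z : Set X, Y.Nonempty ∧ Z.Nonempty ∧ Disjoint Y Z ∧ Y ∪ Z = Set.univ ∧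
    S.IsInvariant Y ∧ S.IsInvariant Z

def Indecomposable {X : Type*} (S : CycleSet X) : Prop :=
  ¬ S.Decomposable

/-- Existence of a bijection that respects the operations. -/
def Isomorphic {X Y : Type*} (S : CycleSet X) (T : CycleSet Y) : Prop :=
  ∃ e : X ≃ Y, ∀ x y, e (S.op x y) = T.op (e x) (e y)

/-- An indecomposable cycle set with `n` elements and abelian permutation group. -/
def IsIndecAbelian {X : Type*} (S : CycleSet X) (n : ℕ) : Prop :=
  Nat.card X = n ∧ S.Indecomposable ∧ IsMulCommutative S.permGroup

/-- Isomorphism, as an equivalence relation on the indecomposable cycle sets with underlying set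
`Fin n` and abelian permutation group. -/
def isoSetoid (n : ℕ) : Setoid {S : CycleSet (Fin n) // S.IsIndecAbelian n} where
  r S T := Isomorphic S.1 T.1
  iseqv :=
    { refl := fun _ => ⟨Equiv.refl _, fun _ _ => rfl⟩
      symm := by
        rintro _ _ ⟨e, he⟩
        refine ⟨e.symm, fun x y => e.injective ?_⟩
        simp [he]
      trans := by
        rintro _ _ _ ⟨e, he⟩ ⟨e', he'⟩
        exact ⟨e.trans e', fun x y => by simp [he, he']⟩ }

/-- The number of isomorphism classes of indecomposable cycle sets of size `n` with abelian
permutation group. -/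
noncomputable def numIsoClasses (n : ℕ) : ℕ :=
  Nat.card (Quotient (isoSetoid n))

/-- `ℤ/nℤ` with `i · j = j + 1`. -/
def shift (n : ℕ) : CycleSet (ZMod n) where
  op _ j := j + 1
  nonempty := ⟨0⟩
  bijective_op _ := (Equiv.addRight (1 : ZMod n)).bijective
  cycle _ _ _ := rfl

/-- The bijections `f : ℤ/pℤ → {0, …, p - 1}` with `f 0 = 0` and
`f (i + 1) + f j ≡ f i + f (j + 1) (mod p)` for all `i, j`. -/
def IsTwist (p : ℕ) (f : ZMod p → Fin p) : Prop :=
  Function.Bijective f ∧ (f 0 : ℕ) = 0 ∧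
    ∀ i j : ZMod p, (f (i + 1) : ℕ) + (f j : ℕ) ≡ (f i : ℕ) + (f (j + 1) : ℕ) [MOD p]

/-- Reduction `ℤ/p²ℤ → ℤ/pℤ`. -/
def red (p : ℕ) : ZMod (p ^ 2) →+* ZMod p :=
  ZMod.castHom (dvd_pow_self p two_ne_zero) (ZMod p)

/-- `ℤ/p²ℤ` with `i · j = j + 1 + p f(i)`. -/
def twisted (p : ℕ) (f : ZMod p → Fin p) (hf : IsTwist p f) : CycleSet (ZMod (p ^ 2)) where
  op i j := j + 1 + (p : ZMod (p ^ 2)) * ((f (red p i) : ℕ) : ZMod (p ^ 2))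
  nonempty := ⟨0⟩
  bijective_op i := by
    simp only [add_assoc]
    exact (Equiv.addRight _).bijective
  cycle x y z := by
    have h := hf.2.2 (red p x) (red p y)
    have h2 := (ZMod.natCast_eq_natCast_iff _ _ _).2 (h.mul_left' p)
    rw [← pow_two] at h2
    push_cast at h2
    simp only [map_add, map_mul, map_one, map_natCast, CharP.cast_eq_zero, zero_mul, add_zero]
    linear_combination -h2

/-- `ℤ/pℤ × ℤ/pℤ` with `(i, s) · (j, t) = (j + 1, t + i)`. -/
def square (p : ℕ) : CycleSet (ZMod p × ZMod p) where
  op a b := (b.1 + 1, b.2 + a.1)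
  nonempty := ⟨0⟩
  bijective_op a := (Equiv.addRight ((1, a.1) : ZMod p × ZMod p)).bijective
  cycle x y z := by
    ext
    · rfl
    · simp only
      ring

end CycleSet

/-!
Let `X` be an indecomposable cycle set whose permutation group `G` is abelian. Indecomposability
means that `G` is transitive, and a transitive abelian permutation group is regular, so `X` may be
identified with the additive group `A` of `G`, where the operation becomes `x · y = y + φ x` for a
map `φ : A → A` whose values generate `A` (`IsIndecAbelian.exists_translations`). The cycle set
identity turns into `φ x + φ (y + φ x) = φ y + φ (x + φ y)`.

Comparing this identity for two points with the same image shows that the fibres of `φ` are exactly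
the cosets of the subgroup `H` of its periods (`apply_eq_iff_sub_mem_periods`). If `H` is trivial and
`A` is finite, then `φ` is bijective, and the identity at the zero of `φ` forces `A` to be trivial
(`subsingleton_of_periods_eq_bot`). Hence over a group of prime order `φ` is constant. If `A` has
order `p * q` and `φ` is not constant, then `H` and `A ⧸ H` have prime order, the map induced on
`A ⧸ H` is constant, and with `g = φ 0` and `c = φ g - g ∈ H` the identity gives
`φ (k • g) = g + k • c`. As `φ` separates the cosets of `H`, the order of `g` modulo `H` equals that
of `c`, which forces `p = q` (`const_or_eq_of_card_eq_mul`). A constant `φ` gives the shift,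
`p • g = 0` gives the model on `ℤ/pℤ × ℤ/pℤ`, and `p • g ≠ 0` gives a twisted model on `ℤ/p²ℤ`.

The left multiplications of the shift are all equal; those of the square model are not, but have
order `p`; those of a twisted model do not all have order `p`. An isomorphism between two twisted
models is an affine map of `ℤ/p²ℤ` with slope congruent to `1` modulo `p`, and therefore preserves
the slope of the twist (`eq_of_isomorphic_twisted`).
-/

namespace CycleSet

/-! ### Isomorphisms and transport of structure -/

theorem Isomorphic.symm {X Y : Type*} {S : CycleSet X} {T : CycleSet Y} (h : S.Isomorphic T) :
    T.Isomorphic S := by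
  obtain ⟨e, he⟩ := h
  exact ⟨e.symm, fun x y => e.injective (by simp [he])⟩

theorem Isomorphic.trans {X Y Z : Type*} {S : CycleSet X} {T : CycleSet Y} {U : CycleSet Z}
    (h : S.Isomorphic T) (h' : T.Isomorphic U) : S.Isomorphic U := by
  obtain ⟨e, he⟩ := h
  obtain ⟨e', he'⟩ := h'
  exact ⟨e.trans e', fun x y => by simp [he, he']⟩

theorem isMulCommutative_permGroup_iff {X : Type*} (S : CycleSet X) :
    IsMulCommutative S.permGroup ↔ ∀ x y z, S.op x (S.op y z) = S.op y (S.op x z) := by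
  constructor
  · intro h x y z
    have := isMulCommutative_iff.1 h ⟨S.sigma x, Subgroup.subset_closure ⟨x, rfl⟩⟩
      ⟨S.sigma y, Subgroup.subset_closure ⟨y, rfl⟩⟩
    exact DFunLike.congr_fun (congrArg Subtype.val this) z
  · intro h
    apply Subgroup.isMulCommutative_closure
    rintro _ ⟨x, rfl⟩ _ ⟨y, rfl⟩
    ext z
    exact h x y z

theorem Isomorphic.indecomposable {X Y : Type*} {S : CycleSet X} {T : CycleSet Y}
    (h : S.Isomorphic T) (hS : S.Indecomposable) : T.Indecomposable := by
  obtain ⟨e, he⟩ := h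
  rintro ⟨U, V, hU, hV, hd, hc, hiU, hiV⟩
  have inv : ∀ W : Set Y, T.IsInvariant W → S.IsInvariant (e ⁻¹' W) := by
    rintro W hW x _ ⟨y, hy, rfl⟩
    change e (S.op x y) ∈ W
    rw [he]
    exact hW (e x) ⟨e y, hy, rfl⟩
  exact hS ⟨e ⁻¹' U, e ⁻¹' V, hU.preimage e.surjective, hV.preimage e.surjective,
    hd.preimage e, by rw [← Set.preimage_union, hc, Set.preimage_univ], inv U hiU, inv V hiV⟩

theorem Isomorphic.isIndecAbelian {X Y : Type*} {S : CycleSet X} {T : CycleSet Y} {n : ℕ}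
    (h : S.Isomorphic T) (hS : S.IsIndecAbelian n) : T.IsIndecAbelian n := by
  refine ⟨?_, h.indecomposable hS.2.1, ?_⟩
  · obtain ⟨e, -⟩ := h
    rw [← hS.1, Nat.card_congr e]
  · have hc := (isMulCommutative_permGroup_iff S).1 hS.2.2
    rw [isMulCommutative_permGroup_iff]
    obtain ⟨e, he⟩ := h.symm
    exact fun x y z => e.injective (by simp only [he, hc (e x)])

/-- The cycle set on `Y` obtained from one on `X` along a bijection `X ≃ Y`. -/
def transport {X Y : Type*} (S : CycleSet X) (e : X ≃ Y) : CycleSet Y where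
  op x y := e (S.op (e.symm x) (e.symm y))
  nonempty := S.nonempty.map e
  bijective_op x := e.bijective.comp ((S.bijective_op _).comp e.symm.bijective)
  cycle x y z := by simp [S.cycle]

theorem isomorphic_transport {X Y : Type*} (S : CycleSet X) (e : X ≃ Y) :
    S.Isomorphic (S.transport e) :=
  ⟨e, fun x y => by simp [transport]⟩

/-! ### Cycle sets of translations on an abelian group -/

section Translations

variable {A : Type*} [AddCommGroup A] {S : CycleSet A} {φ : A → A}

/-- The permutation group of a cycle set of translations is the regular representation of the
group. -/
theorem nonempty_permGroup_mulEquiv (hS : ∀ x y, S.op x y = y + φ x)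
    (hgen : AddSubgroup.closure (Set.range φ) = ⊤) :
    Nonempty (S.permGroup ≃* Multiplicative A) := by
  let f : Multiplicative A →* Equiv.Perm A :=
    { toFun := fun a => Equiv.addRight a.toAdd
      map_one' := by ext; simp
      map_mul' := fun a b => by
        ext x
        change x + (a.toAdd + b.toAdd) = (x + b.toAdd) + a.toAdd
        abel }
  have hf : Function.Injective f := fun a b h => by
    have := DFunLike.congr_fun h (0 : A)
    change 0 + a.toAdd = 0 + b.toAdd at this
    simpa using this
  have hσ : ∀ x, S.sigma x = f (Multiplicative.ofAdd (φ x)) := fun x => by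
    ext y
    exact hS x y
  have hr : S.permGroup = f.range := by
    apply le_antisymm
    · rw [permGroup, Subgroup.closure_le]
      rintro _ ⟨x, rfl⟩
      exact ⟨_, (hσ x).symm⟩
    · rintro _ ⟨a, rfl⟩
      obtain ⟨a, rfl⟩ := Multiplicative.ofAdd.surjective a
      have ha : a ∈ AddSubgroup.closure (Set.range φ) := hgen ▸ AddSubgroup.mem_top _
      induction ha using AddSubgroup.closure_induction with
      | mem b hb =>
        obtain ⟨x, rfl⟩ := hb
        exact Subgroup.subset_closure ⟨x, hσ x⟩
      | zero => simp
      | add b c _ _ hb hc => rw [ofAdd_add, map_mul]; exact mul_mem hb hc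
      | neg b _ hb => rw [ofAdd_neg, map_inv]; exact inv_mem hb
  rw [hr]
  exact ⟨(MonoidHom.ofInjective hf).symm⟩

theorem indecomposable_of_closure_eq_top (hS : ∀ x y, S.op x y = y + φ x)
    (hgen : AddSubgroup.closure (Set.range φ) = ⊤) : S.Indecomposable := by
  rintro ⟨Y, Z, ⟨y, hy⟩, ⟨z, hz⟩, hd, hc, hiY, hiZ⟩
  have key : ∀ a : A, ∀ w, w ∈ Y ↔ w + a ∈ Y := fun a => by
    have ha : a ∈ AddSubgroup.closure (Set.range φ) := hgen ▸ AddSubgroup.mem_top _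
    induction ha using AddSubgroup.closure_induction with
    | mem b hb =>
      obtain ⟨x, rfl⟩ := hb
      intro w
      rw [← hS]
      refine ⟨fun h => hiY x ⟨w, h, rfl⟩, fun h => ?_⟩
      by_contra hw
      have hw' : w ∈ Z := ((Set.ext_iff.1 hc w).2 trivial).resolve_left hw
      exact Set.disjoint_left.1 hd h (hiZ x ⟨w, hw', rfl⟩)
    | zero => simp
    | add b c _ _ hb hc => intro w; rw [hb, hc, add_assoc]
    | neg b _ hb => intro w; rw [hb (w + -b), neg_add_cancel_right]
  have := (key (z - y) y).1 hy
  rw [add_sub_cancel] at this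
  exact Set.disjoint_left.1 hd this hz

theorem isIndecAbelian_of_closure_eq_top (hS : ∀ x y, S.op x y = y + φ x)
    (hgen : AddSubgroup.closure (Set.range φ) = ⊤) {n : ℕ} (hn : Nat.card A = n) :
    S.IsIndecAbelian n := by
  refine ⟨hn, indecomposable_of_closure_eq_top hS hgen, ?_⟩
  rw [isMulCommutative_permGroup_iff]
  intro x y z
  simp only [hS]
  abel

end Translations

theorem Indecomposable.exists_mem_permGroup {X : Type*} {S : CycleSet X} (hS : S.Indecomposable)
    (x y : X) : ∃ g ∈ S.permGroup, g x = y := by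
  by_contra hy
  refine hS ⟨{z | ∃ g ∈ S.permGroup, g x = z}, {z | ∃ g ∈ S.permGroup, g x = z}ᶜ,
    ⟨x, 1, one_mem _, rfl⟩, ⟨y, hy⟩, disjoint_compl_right, Set.union_compl_self _, ?_, ?_⟩
  · rintro w _ ⟨_, ⟨g, hg, rfl⟩, rfl⟩
    exact ⟨S.sigma w * g, mul_mem (Subgroup.subset_closure ⟨w, rfl⟩) hg, rfl⟩
  · rintro w _ ⟨z, hz, rfl⟩ ⟨g, hg, h⟩
    exact hz ⟨(S.sigma w)⁻¹ * g, mul_mem (inv_mem (Subgroup.subset_closure ⟨w, rfl⟩)) hg, by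
      simp [h]⟩

universe u

/-- A transitive abelian permutation group acts regularly, so an indecomposable cycle set with
abelian permutation group is a cycle set of translations on that group. -/
theorem IsIndecAbelian.exists_translations {X : Type u} {S : CycleSet X} {n : ℕ}
    (hS : S.IsIndecAbelian n) :
    ∃ (A : Type u) (_ : AddCommGroup A) (T : CycleSet A) (φ : A → A), Nat.card A = n ∧
      (∀ x y, T.op x y = y + φ x) ∧ AddSubgroup.closure (Set.range φ) = ⊤ ∧ S.Isomorphic T := by
  obtain ⟨hn, hind, hcomm⟩ := hS
  obtain ⟨x₀⟩ := S.nonempty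
  let _ : CommGroup S.permGroup :=
    { (inferInstance : Group S.permGroup) with mul_comm := isMulCommutative_iff.1 hcomm }
  have hbij : Function.Bijective (fun a : Additive S.permGroup => a.toMul.1 x₀) := by
    constructor
    · intro a b hab
      apply Additive.toMul.injective
      ext z
      obtain ⟨g, hg, rfl⟩ := hind.exists_mem_permGroup x₀ z
      have h : ∀ c : S.permGroup, c.1 (g x₀) = g (c.1 x₀) := fun c =>
        DFunLike.congr_fun (congrArg Subtype.val (mul_comm c ⟨g, hg⟩)) x₀
      rw [h, h]
      exact congrArg g hab
    · intro z
      obtain ⟨g, hg, rfl⟩ := hind.exists_mem_permGroup x₀ z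
      exact ⟨Additive.ofMul ⟨g, hg⟩, rfl⟩
  let e := Equiv.ofBijective _ hbij
  let φ : Additive S.permGroup → Additive S.permGroup := fun a =>
    Additive.ofMul ⟨S.sigma (e a), Subgroup.subset_closure ⟨_, rfl⟩⟩
  refine ⟨Additive S.permGroup, inferInstance, S.transport e.symm, φ, ?_, fun a b => ?_, ?_,
    isomorphic_transport S e.symm⟩
  · rw [← hn, Nat.card_congr e]
  · apply e.injective
    rw [add_comm]
    simp only [transport, Equiv.symm_symm, Equiv.apply_symm_apply]
    rfl
  · rw [eq_top_iff]
    rintro a -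
    obtain ⟨⟨g, hg⟩, rfl⟩ := Additive.ofMul.surjective a
    induction hg using Subgroup.closure_induction with
    | mem g hg =>
      obtain ⟨x, rfl⟩ := hg
      apply AddSubgroup.subset_closure
      refine ⟨e.symm x, ?_⟩
      simp [φ]
    | one => exact zero_mem _
    | mul g h hg hh ihg ihh => exact add_mem ihg ihh
    | inv g hg ih => exact neg_mem ih

/-! ### Periods of the translation map -/

section Periods

variable {A : Type*} [AddCommGroup A]

/-- The subgroup of periods of a map on an abelian group. -/
def periods (φ : A → A) : AddSubgroup A where
  carrier := {h | ∀ x, φ (x + h) = φ x}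
  zero_mem' := by simp
  add_mem' := fun {a b} ha hb x => by rw [← add_assoc, hb, ha]
  neg_mem' := fun {a} ha x => by rw [← ha (x + -a), neg_add_cancel_right]

variable {φ : A → A}

/-- The identity satisfied by `φ` when the translations `y ↦ y + φ x` form a cycle set. -/
theorem translation_cycle {S : CycleSet A} (hS : ∀ x y, S.op x y = y + φ x) (x y : A) :
    φ x + φ (y + φ x) = φ y + φ (x + φ y) := by
  have h := S.cycle x y 0
  simpa only [hS, zero_add] using h

/-- The fibres of `φ` are stable under translation: comparing the cycle identity at `x` and at
`y` shows this for translation by a value of `φ`, and the values generate the group. -/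
theorem apply_add_eq_of_apply_eq [Finite A]
    (hφ : ∀ x y, φ x + φ (y + φ x) = φ y + φ (x + φ y))
    (hgen : AddSubgroup.closure (Set.range φ) = ⊤) {x y : A} (hxy : φ x = φ y) (a : A) :
    φ (x + a) = φ (y + a) := by
  have ha : a ∈ AddSubmonoid.closure (Set.range φ) := by
    rw [← AddSubgroup.closure_toAddSubmonoid_of_finite, hgen]
    trivial
  induction ha using AddSubmonoid.closure_induction generalizing x y with
  | mem b hb =>
    obtain ⟨z, rfl⟩ := hb
    have h₁ := hφ x z
    have h₂ := hφ y z
    rw [hxy, h₂] at h₁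
    exact (add_left_cancel h₁).symm
  | zero => simpa using hxy
  | add b c _ _ hb hc => simpa only [add_assoc] using hc (hb hxy)

theorem apply_eq_iff_sub_mem_periods [Finite A]
    (hφ : ∀ x y, φ x + φ (y + φ x) = φ y + φ (x + φ y))
    (hgen : AddSubgroup.closure (Set.range φ) = ⊤) {x y : A} :
    φ x = φ y ↔ x - y ∈ periods φ := by
  constructor
  · intro h z
    have := apply_add_eq_of_apply_eq hφ hgen h (z - y)
    rwa [add_sub_cancel, add_sub_left_comm] at this
  · intro h
    simpa using h y

/-- A solution `φ` without periods is a bijection, and evaluating the cycle identity at its zero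
forces the group to be trivial. -/
theorem subsingleton_of_periods_eq_bot [Finite A]
    (hφ : ∀ x y, φ x + φ (y + φ x) = φ y + φ (x + φ y))
    (hgen : AddSubgroup.closure (Set.range φ) = ⊤) (h : periods φ = ⊥) : Subsingleton A := by
  have hinj : Function.Injective φ := fun x y hxy => by
    rwa [apply_eq_iff_sub_mem_periods hφ hgen, h, AddSubgroup.mem_bot, sub_eq_zero] at hxy
  obtain ⟨x₀, hx₀⟩ := (Finite.surjective_of_injective hinj) 0
  have hz : ∀ y, φ y = 0 := fun y => by
    have h1 := hφ x₀ y
    rw [hx₀, zero_add, add_zero, left_eq_add, ← hx₀] at h1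
    simpa using hinj h1
  exact ⟨fun x y => hinj ((hz x).trans (hz y).symm)⟩

theorem apply_eq_of_periods_eq_top (h : periods φ = ⊤) (x y : A) : φ x = φ y := by
  have : x - y ∈ periods φ := h ▸ AddSubgroup.mem_top _
  simpa using this y

theorem apply_eq_of_prime_card [Finite A] (hA : (Nat.card A).Prime)
    (hφ : ∀ x y, φ x + φ (y + φ x) = φ y + φ (x + φ y))
    (hgen : AddSubgroup.closure (Set.range φ) = ⊤) (x y : A) : φ x = φ y := by
  have := Fact.mk hA
  obtain h | h := (periods φ).eq_bot_or_eq_top_of_prime_card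
  · have := subsingleton_of_periods_eq_bot hφ hgen h
    exact congrArg φ (Subsingleton.elim x y)
  · exact apply_eq_of_periods_eq_top h x y

/-- If the periods have prime index then `φ` is constant modulo its periods: the map it induces on
the quotient is a solution over a group of prime order. -/
theorem apply_sub_apply_mem_periods [Finite A] (hI : (periods φ).index.Prime)
    (hφ : ∀ x y, φ x + φ (y + φ x) = φ y + φ (x + φ y))
    (hgen : AddSubgroup.closure (Set.range φ) = ⊤) (x y : A) : φ x - φ y ∈ periods φ := by
  let π := QuotientAddGroup.mk' (periods φ)
  have hπ : Function.Surjective π := QuotientAddGroup.mk'_surjective _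
  have hker : ∀ a b, π a = π b ↔ φ a = φ b := fun a b => by
    rw [apply_eq_iff_sub_mem_periods hφ hgen, ← QuotientAddGroup.eq_iff_sub_mem]
    rfl
  let ψ : A ⧸ periods φ → A ⧸ periods φ := fun a => π (φ (Function.surjInv hπ a))
  have hψ : ∀ a, ψ (π a) = π (φ a) := fun a =>
    congrArg π ((hker _ _).1 (Function.surjInv_eq hπ (π a)))
  have := apply_eq_of_prime_card (φ := ψ) hI ?_ ?_ (π x) (π y)
  · rwa [hψ, hψ, ← sub_eq_zero, ← map_sub, QuotientAddGroup.mk'_apply,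
      QuotientAddGroup.eq_zero_iff] at this
  · intro a b
    obtain ⟨a, rfl⟩ := hπ a
    obtain ⟨b, rfl⟩ := hπ b
    simp only [hψ, ← map_add, hφ a b]
  · have hr : Set.range ψ = π '' Set.range φ := by
      ext z
      constructor
      · rintro ⟨a, rfl⟩
        exact ⟨_, ⟨_, rfl⟩, rfl⟩
      · rintro ⟨_, ⟨a, rfl⟩, rfl⟩
        exact ⟨π a, hψ a⟩
    rw [hr, ← AddMonoidHom.map_closure, hgen, AddSubgroup.map_top_of_surjective _ hπ]

end Periods

/-! ### Solutions over a group whose order is a product of two primes -/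

theorem _root_.Nat.Prime.prime_and_prime_of_mul_eq {p q a b : ℕ} (hp : p.Prime) (hq : q.Prime)
    (h : a * b = p * q) (ha : a ≠ 1) (hb : b ≠ 1) : a.Prime ∧ b.Prime := by
  wlog hpa : p ∣ a generalizing a b
  · have hpb : p ∣ b := (hp.dvd_mul.1 (h ▸ dvd_mul_right p q)).resolve_left hpa
    exact (this (by rw [mul_comm, h]) hb ha hpb).symm
  obtain ⟨c, rfl⟩ := hpa
  have hcb : c * b = q := Nat.eq_of_mul_eq_mul_left hp.pos (by rw [← h, mul_assoc])
  have hc := Nat.prime_mul_iff.1 (hcb.symm ▸ hq : (c * b).Prime)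
  obtain ⟨hb', rfl⟩ := hc.resolve_left fun h => hb h.2
  exact ⟨by rwa [mul_one], hb'⟩

/-- A solution over a group of order `p * q` is constant, or else `p = q` and it is of the form
`k • g + h ↦ g + k • c` for `h` in the subgroup `H` of periods, which has order `p` and is generated
by `c`. -/
theorem const_or_eq_of_card_eq_mul {A : Type*} [AddCommGroup A] {φ : A → A} {p q : ℕ}
    (hp : p.Prime) (hq : q.Prime) (hA : Nat.card A = p * q)
    (hφ : ∀ x y, φ x + φ (y + φ x) = φ y + φ (x + φ y))
    (hgen : AddSubgroup.closure (Set.range φ) = ⊤) :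
    (∀ x y, φ x = φ y) ∨ p = q ∧ ∃ (g c : A) (H : AddSubgroup A),
      (∀ x, ∀ h ∈ H, φ (x + h) = φ x) ∧ (∀ k : ℕ, φ (k • g) = g + k • c) ∧
      (∀ k : ℕ, k • g ∈ H ↔ p ∣ k) ∧ Nat.card H = p ∧ c ∈ H ∧ c ≠ 0 := by
  have : Finite A := Nat.finite_of_card_ne_zero (hA ▸ (mul_pos hp.pos hq.pos).ne')
  by_cases htop : periods φ = ⊤
  · exact Or.inl (apply_eq_of_periods_eq_top htop)
  have hbot : periods φ ≠ ⊥ := fun h => by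
    have := subsingleton_of_periods_eq_bot hφ hgen h
    rw [Nat.card_of_subsingleton (0 : A)] at hA
    exact hp.one_lt.ne' (Nat.eq_one_of_mul_eq_one_right hA.symm)
  have hcard : Nat.card (periods φ) * (periods φ).index = p * q := by
    rw [AddSubgroup.card_mul_index, hA]
  obtain ⟨hH, hI⟩ := hp.prime_and_prime_of_mul_eq hq hcard
    (fun h => hbot (AddSubgroup.card_eq_one.1 h)) (fun h => htop (AddSubgroup.index_eq_one.1 h))
  have hmem := apply_sub_apply_mem_periods hI hφ hgen
  set g := φ 0 with hg
  set c := φ g - g with hc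
  have hiff : ∀ {x y}, φ x = φ y ↔ x - y ∈ periods φ := apply_eq_iff_sub_mem_periods hφ hgen
  have hstep : ∀ x, φ (x + g) = φ x + c := fun x => by
    have h1 : ∀ x y, φ (y + φ x) = φ (y + g) := fun x y => hiff.2 (by simpa using hmem x 0)
    have h2 := hφ x 0
    rw [h1, h1, zero_add, ← hg] at h2
    rw [hc, add_sub, h2, add_sub_cancel_left]
  have hk : ∀ k : ℕ, φ (k • g) = g + k • c := fun k => by
    induction k with
    | zero => simp [hg]
    | succ k ih => rw [succ_nsmul, hstep, ih, succ_nsmul, add_assoc]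
  have hcH : c ∈ periods φ := hmem g 0
  have hc0 : c ≠ 0 := fun h => by
    have hgH : g ∈ periods φ := by
      have : φ g = φ 0 := by rw [← hg, ← sub_eq_zero, ← hc, h]
      simpa using hiff.1 this
    refine htop (eq_top_iff.2 (hgen ▸ (AddSubgroup.closure_le _).2 ?_))
    rintro _ ⟨x, rfl⟩
    rw [← sub_add_cancel (φ x) g]
    exact add_mem (hmem x 0) hgH
  have hord : addOrderOf c = Nat.card (periods φ) := by
    have h1 : addOrderOf (⟨c, hcH⟩ : periods φ) ∣ Nat.card (periods φ) := addOrderOf_dvd_natCard _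
    rw [AddSubgroup.addOrderOf_mk] at h1
    exact (hH.eq_one_or_self_of_dvd _ h1).resolve_left (by simpa using hc0)
  have hgH : ∀ k : ℕ, k • g ∈ periods φ ↔ Nat.card (periods φ) ∣ k := fun k => by
    rw [← hord, addOrderOf_dvd_iff_nsmul_eq_zero]
    have := @hiff (k • g) 0
    rw [sub_zero] at this
    rw [← this, hk, ← hg, add_eq_left]
  have hIH : Nat.card (periods φ) = (periods φ).index :=
    (Nat.prime_dvd_prime_iff_eq hH hI).1 ((hgH _).1 (AddSubgroup.nsmul_index_mem _ _))
  have hpH : p = Nat.card (periods φ) := (Nat.prime_dvd_prime_iff_eq hp hH).1 (by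
    have : p ∣ Nat.card (periods φ) * (periods φ).index := hcard ▸ dvd_mul_right p q
    rw [← hIH, hp.dvd_mul, or_self] at this
    exact this)
  have hqH : q = Nat.card (periods φ) := (Nat.prime_dvd_prime_iff_eq hq hH).1 (by
    have : q ∣ Nat.card (periods φ) * (periods φ).index := hcard ▸ dvd_mul_left q p
    rw [← hIH, hq.dvd_mul, or_self] at this
    exact this)
  exact Or.inr ⟨hpH.trans hqH.symm, g, c, periods φ, fun x h hh => hh x, hk,
    fun k => hpH ▸ hgH k, hpH.symm, hcH, hc0⟩

/-! ### Recognizing the models -/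

section Recognition

variable {A : Type*} [AddCommGroup A] {S : CycleSet A} {φ : A → A}

theorem exists_zmod_hom {n : ℕ} {g : A} (hg : n • g = 0) :
    ∃ e : ZMod n →+ A, ∀ k : ℕ, e k = k • g :=
  ⟨ZMod.lift n ⟨zmultiplesHom A g, by simpa using hg⟩, fun k => by
    have := ZMod.lift_coe n ⟨zmultiplesHom A g, by simpa using hg⟩ (k : ℤ)
    simpa using this⟩

theorem isomorphic_shift_of_const {n : ℕ} [NeZero n] (hA : Nat.card A = n)
    (hS : ∀ x y, S.op x y = y + φ x) (hgen : AddSubgroup.closure (Set.range φ) = ⊤)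
    (hconst : ∀ x y, φ x = φ y) : S.Isomorphic (shift n) := by
  obtain ⟨e, he⟩ := exists_zmod_hom (n := n) (g := φ 0) (hA ▸ card_nsmul_eq_zero')
  have he1 : ∀ x, e 1 = φ x := fun x => by
    have := he 1
    rwa [Nat.cast_one, one_nsmul, hconst 0 x] at this
  have hsurj : Function.Surjective e := by
    rw [← AddMonoidHom.range_eq_top, eq_top_iff, ← hgen, AddSubgroup.closure_le]
    rintro _ ⟨x, rfl⟩
    exact ⟨1, he1 x⟩
  have hbij := hsurj.bijective_of_nat_card_le (by rw [hA, Nat.card_zmod])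
  refine Isomorphic.symm ⟨Equiv.ofBijective e hbij, fun x y => ?_⟩
  change e (y + 1) = S.op (e x) (e y)
  rw [map_add, hS, ← he1]

variable {p : ℕ} {g c : A} {H : AddSubgroup A}

/-- If `g` has order `p` in the non-constant case, then `A` is the direct sum of the groups
generated by `g` and `c`, and in these coordinates `φ` is `(i, s) ↦ (1, i)`. -/
theorem isomorphic_square (hp : p.Prime) (hA : Nat.card A = p ^ 2)
    (hS : ∀ x y, S.op x y = y + φ x)
    (hH : ∀ x, ∀ h ∈ H, φ (x + h) = φ x) (hφ : ∀ k : ℕ, φ (k • g) = g + k • c)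
    (hgH : ∀ k : ℕ, k • g ∈ H ↔ p ∣ k) (hcH : c ∈ H) (hc : addOrderOf c = p)
    (hg : p • g = 0) : S.Isomorphic (square p) := by
  have : NeZero p := ⟨hp.ne_zero⟩
  have : Finite A := Nat.finite_of_card_ne_zero (hA ▸ pow_ne_zero 2 hp.ne_zero)
  obtain ⟨e₁, he₁⟩ := exists_zmod_hom hg
  obtain ⟨e₂, he₂⟩ := exists_zmod_hom (n := p) (g := c) (by rw [← hc, addOrderOf_nsmul_eq_zero])
  have hinj : Function.Injective (e₁.coprod e₂) := by
    rw [injective_iff_map_eq_zero]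
    rintro ⟨i, s⟩ h
    obtain ⟨i, rfl⟩ := ZMod.natCast_zmod_surjective i
    obtain ⟨s, rfl⟩ := ZMod.natCast_zmod_surjective s
    rw [AddMonoidHom.coprod_apply, he₁, he₂] at h
    -- modulo `H` only the first coordinate survives
    have hi : p ∣ i := by
      rw [← hgH, eq_neg_of_add_eq_zero_left h]
      exact neg_mem (nsmul_mem hcH _)
    have hi0 : i • g = 0 := by
      obtain ⟨m, rfl⟩ := hi
      rw [mul_comm, mul_nsmul', hg, nsmul_zero]
    rw [hi0, zero_add, ← addOrderOf_dvd_iff_nsmul_eq_zero, hc] at h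
    rw [(ZMod.natCast_eq_zero_iff _ _).2 hi, (ZMod.natCast_eq_zero_iff _ _).2 h, Prod.mk_zero_zero]
  have hbij := hinj.bijective_of_nat_card_le (by rw [hA, Nat.card_prod, Nat.card_zmod, pow_two])
  refine Isomorphic.symm ⟨Equiv.ofBijective _ hbij, ?_⟩
  rintro ⟨i, s⟩ ⟨j, t⟩
  obtain ⟨i, rfl⟩ := ZMod.natCast_zmod_surjective i
  obtain ⟨s, rfl⟩ := ZMod.natCast_zmod_surjective s
  change e₁ (j + 1) + e₂ (t + i) = S.op (e₁ i + e₂ s) (e₁ j + e₂ t)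
  have h1 : e₁ 1 = g := by simpa using he₁ 1
  rw [hS, he₂ s, hH _ _ (nsmul_mem hcH _), he₁ i, hφ, map_add, map_add, he₂, h1]
  abel

/-- The function `k ↦ k * t` from `ℤ/pℤ` to `{0, …, p - 1}`. -/
def mulTwist (p : ℕ) [NeZero p] (t k : ZMod p) : Fin p :=
  ⟨(k * t).val, ZMod.val_lt _⟩

theorem isTwist_iff (hp : p.Prime) (f : ZMod p → Fin p) :
    IsTwist p f ↔ ∃ t : ZMod p, t ≠ 0 ∧ ∀ k, (f k : ℕ) = (k * t).val := by
  have := Fact.mk hp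
  constructor
  · rintro ⟨hb, h0, hf⟩
    have hlin : ∀ k : ℕ, ((f k : ℕ) : ZMod p) = k * ((f 1 : ℕ) : ZMod p) := fun k => by
      induction k with
      | zero => simp [h0]
      | succ k ih =>
        have := (ZMod.natCast_eq_natCast_iff _ _ _).2 (hf k 0)
        push_cast at this ⊢
        rw [h0, zero_add, ih] at this
        linear_combination this
    refine ⟨((f 1 : ℕ) : ZMod p), fun h => ?_, fun k => ?_⟩
    · have h1 : (f 1 : ℕ) = 0 := Nat.eq_zero_of_dvd_of_lt ((ZMod.natCast_eq_zero_iff _ _).1 h)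
        (f 1).2
      exact one_ne_zero (hb.1 (Fin.ext (h1.trans h0.symm)))
    · obtain ⟨k, rfl⟩ := ZMod.natCast_zmod_surjective k
      rw [← hlin, ZMod.val_natCast, Nat.mod_eq_of_lt (f k).2]
  · rintro ⟨t, ht, hf⟩
    refine ⟨?_, by simp [hf], fun i j => ?_⟩
    · rw [Fintype.bijective_iff_injective_and_card]
      refine ⟨fun i j hij => ?_, by simp [ZMod.card]⟩
      have := congrArg Fin.val hij
      rw [hf, hf] at this
      exact mul_right_cancel₀ ht (ZMod.val_injective p this)
    · rw [← ZMod.natCast_eq_natCast_iff]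
      push_cast
      rw [hf, hf, hf, hf]
      simp only [ZMod.natCast_val, ZMod.cast_id', id_eq]
      ring

theorem isTwist_mulTwist (hp : p.Prime) [NeZero p] {t : ZMod p} (ht : t ≠ 0) :
    IsTwist p (mulTwist p t) :=
  (isTwist_iff hp _).2 ⟨t, ht, fun _ => rfl⟩

/-- A twist is determined by its slope, an arbitrary nonzero element of `ℤ/pℤ`. -/
theorem card_isTwist (hp : p.Prime) : Nat.card {f : ZMod p → Fin p // IsTwist p f} = p - 1 := by
  have := Fact.mk hp
  have hb : Function.Bijective (fun t : {t : ZMod p // t ≠ 0} =>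
      (⟨mulTwist p t.1, isTwist_mulTwist hp t.2⟩ : {f : ZMod p → Fin p // IsTwist p f})) := by
    constructor
    · intro s t h
      have := congrArg Fin.val (congrFun (congrArg Subtype.val h) 1)
      simpa [mulTwist, Subtype.ext_iff] using ZMod.val_injective p this
    · rintro ⟨f, hf⟩
      obtain ⟨t, ht, h⟩ := (isTwist_iff hp f).1 hf
      exact ⟨⟨t, ht⟩, Subtype.ext (funext fun k => Fin.ext (h k).symm)⟩
  rw [← Nat.card_congr (Equiv.ofBijective _ hb), Nat.card_eq_fintype_card,
    Fintype.card_subtype_compl, ZMod.card, Fintype.card_unique]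

/-- If `p • g ≠ 0` in the non-constant case, then `A` is cyclic with generator `g`, and in this
coordinate `φ` is `i ↦ 1 + p * (i * t)`, where `c = t • (p • g)`. -/
theorem isomorphic_twisted (hp : p.Prime) (hA : Nat.card A = p ^ 2)
    (hS : ∀ x y, S.op x y = y + φ x)
    (hφ : ∀ k : ℕ, φ (k • g) = g + k • c)
    (hgH : ∀ k : ℕ, k • g ∈ H ↔ p ∣ k) (hcard : Nat.card H = p) (hcH : c ∈ H) (hc : c ≠ 0)
    (hg : p • g ≠ 0) :
    ∃ (f : ZMod p → Fin p) (hf : IsTwist p f), S.Isomorphic (twisted p f hf) := by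
  have := Fact.mk hp
  have : Finite A := Nat.finite_of_card_ne_zero (hA ▸ pow_ne_zero 2 hp.ne_zero)
  obtain ⟨e, he⟩ := exists_zmod_hom (n := p ^ 2) (g := g) (hA ▸ card_nsmul_eq_zero')
  have hpg : p • (p • g) = 0 := by
    rw [← mul_nsmul', ← pow_two, ← hA, card_nsmul_eq_zero']
  have hord : addOrderOf (p • g) = p := addOrderOf_eq_prime hpg hg
  have hinj : Function.Injective e := by
    rw [injective_iff_map_eq_zero]
    intro i h
    obtain ⟨i, rfl⟩ := ZMod.natCast_zmod_surjective i
    rw [he] at h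
    obtain ⟨m, rfl⟩ := (hgH i).1 (h ▸ zero_mem H)
    rw [mul_comm, mul_nsmul', ← addOrderOf_dvd_iff_nsmul_eq_zero, hord] at h
    rw [ZMod.natCast_eq_zero_iff, pow_two]
    exact mul_dvd_mul_left p h
  have hbij := hinj.bijective_of_nat_card_le (by rw [hA, Nat.card_zmod])
  -- `p • g` is a nonzero element of `H`, which has prime order, so `c` is one of its multiples
  obtain ⟨m, hm⟩ : ∃ m : ℕ, m • (p • g) = c := by
    have h0 : (⟨p • g, (hgH p).2 dvd_rfl⟩ : H) ≠ 0 := fun h => hg (congrArg Subtype.val h)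
    have := mem_multiples_of_prime_card hcard (g' := ⟨c, hcH⟩) h0
    obtain ⟨m, hm⟩ := this
    exact ⟨m, congrArg Subtype.val hm⟩
  have ht : (m : ZMod p) ≠ 0 := fun h => hc (by
    rw [← hm, ← addOrderOf_dvd_iff_nsmul_eq_zero, hord]
    exact (ZMod.natCast_eq_zero_iff _ _).1 h)
  refine ⟨mulTwist p m, isTwist_mulTwist hp ht, Isomorphic.symm ⟨Equiv.ofBijective e hbij, ?_⟩⟩
  intro i j
  obtain ⟨i, rfl⟩ := ZMod.natCast_zmod_surjective i
  change e (j + 1 + (p : ZMod (p ^ 2)) * ((mulTwist p m (red p i) : ℕ) : ZMod (p ^ 2))) =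
    S.op (e i) (e j)
  have hval : ((mulTwist p m (red p i) : ℕ)) = (i * m) % p := by
    change (red p i * (m : ZMod p)).val = _
    rw [map_natCast, ← Nat.cast_mul, ZMod.val_natCast]
  have h1 : e 1 = g := by simpa using he 1
  have h2 : ((i * m) % p) • (p • g) = i • c := by
    have := mod_addOrderOf_nsmul (p • g) (i * m)
    rwa [hord, mul_nsmul', hm] at this
  rw [hval, hS, he, hφ, map_add, map_add, h1, ← Nat.cast_mul, he, mul_comm, mul_nsmul', h2,
    add_assoc]

end Recognition

theorem IsIndecAbelian.isomorphic_shift {X : Type*} {S : CycleSet X} {p q : ℕ} (hp : p.Prime)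
    (hq : q.Prime) (hpq : p ≠ q) (hS : S.IsIndecAbelian (p * q)) :
    S.Isomorphic (shift (p * q)) := by
  have : NeZero (p * q) := ⟨(mul_pos hp.pos hq.pos).ne'⟩
  obtain ⟨A, _, T, φ, hA, hT, hgen, hST⟩ := hS.exists_translations
  obtain h | h := const_or_eq_of_card_eq_mul hp hq hA (translation_cycle hT) hgen
  · exact hST.trans (isomorphic_shift_of_const hA hT hgen h)
  · exact absurd h.1 hpq

theorem IsIndecAbelian.isomorphic_of_prime_sq {X : Type*} {S : CycleSet X} {p : ℕ} (hp : p.Prime)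
    (hS : S.IsIndecAbelian (p ^ 2)) : S.Isomorphic (shift (p ^ 2)) ∨
      (∃ (f : ZMod p → Fin p) (hf : IsTwist p f), S.Isomorphic (twisted p f hf)) ∨
      S.Isomorphic (square p) := by
  have := Fact.mk hp
  obtain ⟨A, _, T, φ, hA, hT, hgen, hST⟩ := hS.exists_translations
  obtain h | ⟨-, g, c, H, hH, hφ, hgH, hcard, hcH, hc⟩ :=
    const_or_eq_of_card_eq_mul hp hp (hA.trans (pow_two p)) (translation_cycle hT) hgen
  · exact Or.inl (hST.trans (isomorphic_shift_of_const hA hT hgen h))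
  · by_cases hg : p • g = 0
    · have hpc : p • c = 0 := by
        have : p • (⟨c, hcH⟩ : H) = 0 := by rw [← hcard, card_nsmul_eq_zero']
        exact congrArg Subtype.val this
      exact Or.inr (Or.inr (hST.trans (isomorphic_square hp hA hT hH hφ hgH hcH
        (addOrderOf_eq_prime hpc hc) hg)))
    · obtain ⟨f, hf, h⟩ := isomorphic_twisted hp hA hT hφ hgH hcard hcH hc hg
      exact Or.inr (Or.inl ⟨f, hf, hST.trans h⟩)

/-! ### Properties of the models -/

theorem closure_range_zmod {n : ℕ} {φ : ZMod n → ZMod n} {x : ZMod n} (h : φ x = 1) :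
    AddSubgroup.closure (Set.range φ) = ⊤ := by
  have h1 : (1 : ZMod n) ∈ AddSubgroup.closure (Set.range φ) := AddSubgroup.subset_closure ⟨x, h⟩
  rw [eq_top_iff]
  rintro a -
  obtain ⟨a, rfl⟩ := ZMod.intCast_surjective a
  rw [← zsmul_one]
  exact zsmul_mem h1 a

theorem shift_properties (n : ℕ) : (shift n).IsIndecAbelian n ∧
    Nonempty ((shift n).permGroup ≃* Multiplicative (ZMod n)) := by
  let φ : ZMod n → ZMod n := fun _ => 1
  have hS : ∀ x y, (shift n).op x y = y + φ x := fun _ _ => rfl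
  have hgen : AddSubgroup.closure (Set.range φ) = ⊤ := closure_range_zmod (x := 0) rfl
  exact ⟨isIndecAbelian_of_closure_eq_top hS hgen (Nat.card_zmod n),
    nonempty_permGroup_mulEquiv hS hgen⟩

theorem twisted_properties {p : ℕ} (f : ZMod p → Fin p) (hf : IsTwist p f) :
    (twisted p f hf).IsIndecAbelian (p ^ 2) ∧
    Nonempty ((twisted p f hf).permGroup ≃* Multiplicative (ZMod (p ^ 2))) := by
  let φ : ZMod (p ^ 2) → ZMod (p ^ 2) := fun x => 1 + p * ((f (red p x) : ℕ) : ZMod (p ^ 2))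
  have hS : ∀ x y, (twisted p f hf).op x y = y + φ x := fun _ _ => add_assoc _ _ _
  have hgen : AddSubgroup.closure (Set.range φ) = ⊤ :=
    closure_range_zmod (x := 0) (by simp [φ, hf.2.1])
  exact ⟨isIndecAbelian_of_closure_eq_top hS hgen (Nat.card_zmod _),
    nonempty_permGroup_mulEquiv hS hgen⟩

theorem square_properties (p : ℕ) : (square p).IsIndecAbelian (p ^ 2) ∧
    Nonempty ((square p).permGroup ≃* Multiplicative (ZMod p × ZMod p)) := by
  let φ : ZMod p × ZMod p → ZMod p × ZMod p := fun a => (1, a.1)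
  have hS : ∀ x y, (square p).op x y = y + φ x := fun _ _ => rfl
  have hgen : AddSubgroup.closure (Set.range φ) = ⊤ := by
    rw [eq_top_iff]
    rintro ⟨a, b⟩ -
    obtain ⟨a, rfl⟩ := ZMod.intCast_surjective a
    obtain ⟨b, rfl⟩ := ZMod.intCast_surjective b
    have h : ((a : ZMod p), (b : ZMod p)) = a • φ 0 + b • (φ (1, 0) - φ 0) := by
      ext <;> simp [φ]
    have hmem : ∀ x, φ x ∈ AddSubgroup.closure (Set.range φ) := fun x =>
      AddSubgroup.subset_closure ⟨x, rfl⟩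
    rw [h]
    exact add_mem (zsmul_mem (hmem _) _) (zsmul_mem (sub_mem (hmem _) (hmem _)) _)
  exact ⟨isIndecAbelian_of_closure_eq_top hS hgen (by rw [Nat.card_prod, Nat.card_zmod, pow_two]),
    nonempty_permGroup_mulEquiv hS hgen⟩

/-! ### The models are pairwise non-isomorphic -/

/-- Equality of all left multiplications is an isomorphism invariant. -/
theorem Isomorphic.op_eq_op {X Y : Type*} {S : CycleSet X} {T : CycleSet Y} (h : S.Isomorphic T)
    (hT : ∀ x y z, T.op x z = T.op y z) (x y z : X) : S.op x z = S.op y z := by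
  obtain ⟨e, he⟩ := h
  exact e.injective (by rw [he, he, hT])

/-- The left multiplications all having order dividing `n` is an isomorphism invariant. -/
theorem Isomorphic.iterate_op {X Y : Type*} {S : CycleSet X} {T : CycleSet Y} {n : ℕ}
    (h : S.Isomorphic T) (hT : ∀ x y, (T.op x)^[n] y = y) (x y : X) : (S.op x)^[n] y = y := by
  obtain ⟨e, he⟩ := h
  have hs : Function.Semiconj e (S.op x) (T.op (e x)) := he x
  exact e.injective (by rw [hs.iterate_right n, hT])

theorem natCast_mul_natCast_eq_iff {p : ℕ} (hp : p ≠ 0) (a b : ℕ) :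
    (p : ZMod (p ^ 2)) * a = p * b ↔ (a : ZMod p) = b := by
  rw [← Nat.cast_mul, ← Nat.cast_mul, ZMod.natCast_eq_natCast_iff, ZMod.natCast_eq_natCast_iff,
    pow_two]
  exact Nat.ModEq.mul_left_cancel_iff' hp

theorem not_isomorphic_twisted_shift {p : ℕ} (hp : p.Prime) {f : ZMod p → Fin p}
    (hf : IsTwist p f) : ¬ (twisted p f hf).Isomorphic (shift (p ^ 2)) := by
  intro h
  have := Fact.mk hp
  have h1 := h.op_eq_op (fun _ _ _ => rfl) 1 0 0
  have h2 := (natCast_mul_natCast_eq_iff hp.ne_zero _ _).1 (add_left_cancel h1)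
  rw [ZMod.natCast_eq_natCast_iff', Nat.mod_eq_of_lt (Fin.is_lt _), Nat.mod_eq_of_lt (Fin.is_lt _),
    map_one, map_zero] at h2
  exact one_ne_zero (hf.1.1 (Fin.ext h2))

theorem not_isomorphic_twisted_square {p : ℕ} (hp : p.Prime) {f : ZMod p → Fin p}
    (hf : IsTwist p f) : ¬ (twisted p f hf).Isomorphic (square p) := by
  intro h
  have hsq : ∀ (n : ℕ) x y, ((square p).op x)^[n] y = y + n • ((1, x.1) : ZMod p × ZMod p) := by
    intro n x y
    induction n with
    | zero => simp
    | succ n ih =>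
      rw [Function.iterate_succ_apply', ih, succ_nsmul, ← add_assoc]
      rfl
  have htw : ∀ n : ℕ, ((twisted p f hf).op 0)^[n] 0 = n := by
    intro n
    induction n with
    | zero => simp
    | succ n ih =>
      rw [Function.iterate_succ_apply', ih]
      simp [twisted, hf.2.1]
  have h1 := h.iterate_op (n := p) (fun x y => by rw [hsq]; ext <;> simp) 0 0
  rw [htw, ZMod.natCast_eq_zero_iff] at h1
  have := Nat.le_of_dvd hp.pos h1
  nlinarith [hp.one_lt]

theorem not_isomorphic_square_shift {p : ℕ} (hp : p.Prime) :
    ¬ (square p).Isomorphic (shift (p ^ 2)) := by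
  intro h
  have := Fact.mk hp
  have h1 := congrArg Prod.snd (h.op_eq_op (fun _ _ _ => rfl) (1, 0) 0 0)
  simp [square] at h1

/-- An isomorphism between twisted cycle sets is affine with slope `≡ 1` modulo `p`, so that it
carries the slope of one twist to the slope of the other. -/
theorem eq_of_isomorphic_twisted {p : ℕ} (hp : p.Prime) {f g : ZMod p → Fin p}
    (hf : IsTwist p f) (hg : IsTwist p g)
    (h : (twisted p f hf).Isomorphic (twisted p g hg)) : f = g := by
  have := Fact.mk hp
  obtain ⟨e, he⟩ := h
  obtain ⟨t, -, ht⟩ := (isTwist_iff hp f).1 hf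
  obtain ⟨s, -, hs⟩ := (isTwist_iff hp g).1 hg
  have he' : ∀ x y, e (y + 1 + p * ((f (red p x) : ℕ) : ZMod (p ^ 2))) =
      e y + 1 + p * ((g (red p (e x)) : ℕ) : ZMod (p ^ 2)) := he
  set u : ZMod (p ^ 2) := 1 + (p : ZMod (p ^ 2)) * ((g (red p (e 0)) : ℕ) : ZMod (p ^ 2)) with hu
  have hstep : ∀ k : ℕ, e k = e 0 + k * u := fun k => by
    induction k with
    | zero => simp
    | succ k ih =>
      have := he' 0 k
      rw [map_zero, hf.2.1, Nat.cast_zero, mul_zero, add_zero, ih] at this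
      rw [Nat.cast_succ, this, hu]
      ring
  have hp2 : (p : ZMod (p ^ 2)) * p = 0 := by
    rw [← Nat.cast_mul, ← pow_two, ZMod.natCast_self]
  have h1 : e 1 = e 0 + u := by simpa using hstep 1
  -- the isomorphism applied to `1 · 0`, computed on both sides
  have h2 := he' 1 0
  have h3 := hstep (1 + p * (f 1 : ℕ))
  push_cast at h3
  rw [map_one, zero_add, h3] at h2
  have h4 : (p : ZMod (p ^ 2)) * ((f 1 + g (red p (e 0)) : ℕ) : ZMod (p ^ 2)) =
      p * ((g (red p (e 1)) : ℕ) : ZMod (p ^ 2)) := by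
    push_cast
    linear_combination h2 - ((f 1 : ℕ) : ZMod (p ^ 2)) * ((g (red p (e 0)) : ℕ) : ZMod (p ^ 2)) * hp2
      - (1 + (p : ZMod (p ^ 2)) * ((f 1 : ℕ) : ZMod (p ^ 2))) * hu
  rw [natCast_mul_natCast_eq_iff hp.ne_zero, Nat.cast_add, ht, hs, hs, h1, hu] at h4
  simp only [ZMod.natCast_val, ZMod.cast_id', id_eq, map_add, map_mul, map_one, map_natCast,
    CharP.cast_eq_zero, zero_mul, add_zero] at h4
  have hts : t = s := by linear_combination h4
  funext k
  exact Fin.ext (by rw [ht, hs, hts])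

/-! ### Counting isomorphism classes -/

theorem numIsoClasses_eq_card {n : ℕ} (hn : n ≠ 0) {ι : Type*} (M : ι → Σ X : Type, CycleSet X)
    (hM : ∀ i, (M i).2.IsIndecAbelian n)
    (hinj : ∀ i j, (M i).2.Isomorphic (M j).2 → i = j)
    (hsurj : ∀ S : CycleSet (Fin n), S.IsIndecAbelian n → ∃ i, S.Isomorphic (M i).2) :
    numIsoClasses n = Nat.card ι := by
  have hrep : ∀ i, ∃ S : {S : CycleSet (Fin n) // S.IsIndecAbelian n},
      (M i).2.Isomorphic S.1 := fun i => by
    have : Finite (M i).1 := Nat.finite_of_card_ne_zero ((hM i).1.symm ▸ hn)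
    have h := isomorphic_transport (M i).2 (Finite.equivFinOfCardEq (hM i).1)
    exact ⟨⟨_, h.isIndecAbelian (hM i)⟩, h⟩
  choose R hR using hrep
  refine (Nat.card_congr (Equiv.ofBijective
    (fun i => (Quotient.mk (isoSetoid n) (R i))) ⟨fun i j hij => ?_, fun Q => ?_⟩)).symm
  · have h : (R i).1.Isomorphic (R j).1 := Quotient.exact hij
    exact hinj i j (((hR i).trans h).trans (hR j).symm)
  · induction Q using Quotient.inductionOn with
    | h S =>
      obtain ⟨i, hi⟩ := hsurj S.1 S.2
      exact ⟨i, Quotient.sound (show (R i).1.Isomorphic S.1 from (hi.trans (hR i)).symm)⟩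

theorem numIsoClasses_mul {p q : ℕ} (hp : p.Prime) (hq : q.Prime) (hpq : p ≠ q) :
    numIsoClasses (p * q) = 1 := by
  rw [numIsoClasses_eq_card (mul_pos hp.pos hq.pos).ne'
    (fun _ : Unit => ⟨_, shift (p * q)⟩) (fun _ => (shift_properties _).1) (fun _ _ _ => rfl)
    (fun S hS => ⟨(), hS.isomorphic_shift hp hq hpq⟩), Nat.card_unique]

/-- The `p + 1` models of order `p ^ 2`. -/
def model (p : ℕ) : Option (Option {f : ZMod p → Fin p // IsTwist p f}) → Σ X : Type, CycleSet X
  | none => ⟨_, square p⟩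
  | some none => ⟨_, shift (p ^ 2)⟩
  | some (some f) => ⟨_, twisted p f.1 f.2⟩

theorem numIsoClasses_sq {p : ℕ} (hp : p.Prime) : numIsoClasses (p ^ 2) = p + 1 := by
  have := Fact.mk hp
  rw [numIsoClasses_eq_card (pow_ne_zero 2 hp.ne_zero) (model p), Finite.card_option,
    Finite.card_option, card_isTwist hp, Nat.sub_add_cancel hp.one_le]
  · rintro (_ | _ | f)
    · exact (square_properties p).1
    · exact (shift_properties _).1
    · exact (twisted_properties f.1 f.2).1
  · rintro (_ | _ | f) (_ | _ | g) h
    · rfl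
    · exact absurd h (not_isomorphic_square_shift hp)
    · exact absurd h.symm (not_isomorphic_twisted_square hp g.2)
    · exact absurd h.symm (not_isomorphic_square_shift hp)
    · rfl
    · exact absurd h.symm (not_isomorphic_twisted_shift hp g.2)
    · exact absurd h (not_isomorphic_twisted_square hp f.2)
    · exact absurd h (not_isomorphic_twisted_shift hp f.2)
    · rw [Subtype.ext (eq_of_isomorphic_twisted hp f.2 g.2 h)]
  · intro S hS
    obtain h | ⟨f, hf, h⟩ | h := hS.isomorphic_of_prime_sq hp
    · exact ⟨some none, h⟩
    · exact ⟨some (some ⟨f, hf⟩), h⟩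
    · exact ⟨none, h⟩

end CycleSet

theorem mainTheorem1 (p q : ℕ) (hp : p.Prime) (hq : q.Prime) :
    (p ≠ q →
      (CycleSet.shift (p * q)).IsIndecAbelian (p * q) ∧
      Nonempty ((CycleSet.shift (p * q)).permGroup ≃* Multiplicative (ZMod (p * q))) ∧
      (∀ (X : Type*) (S : CycleSet X), S.IsIndecAbelian (p * q) →
        S.Isomorphic (CycleSet.shift (p * q))) ∧
      CycleSet.numIsoClasses (p * q) = 1) ∧
    (p = q →
      -- the listed cycle sets have the required properties; their permutation groups
      ((CycleSet.shift (p ^ 2)).IsIndecAbelian (p ^ 2) ∧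
        Nonempty ((CycleSet.shift (p ^ 2)).permGroup ≃* Multiplicative (ZMod (p ^ 2)))) ∧
      (∀ (f : ZMod p → Fin p) (hf : CycleSet.IsTwist p f),
        (CycleSet.twisted p f hf).IsIndecAbelian (p ^ 2) ∧
        Nonempty ((CycleSet.twisted p f hf).permGroup ≃* Multiplicative (ZMod (p ^ 2)))) ∧
      ((CycleSet.square p).IsIndecAbelian (p ^ 2) ∧
        Nonempty ((CycleSet.square p).permGroup ≃* Multiplicative (ZMod p × ZMod p))) ∧
      -- the list is complete
      (∀ (X : Type*) (S : CycleSet X), S.IsIndecAbelian (p ^ 2) →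
        S.Isomorphic (CycleSet.shift (p ^ 2)) ∨
        (∃ (f : ZMod p → Fin p) (hf : CycleSet.IsTwist p f),
          S.Isomorphic (CycleSet.twisted p f hf)) ∨
        S.Isomorphic (CycleSet.square p)) ∧
      -- the list has no repetitions
      (∀ (f : ZMod p → Fin p) (hf : CycleSet.IsTwist p f),
        ¬ (CycleSet.twisted p f hf).Isomorphic (CycleSet.shift (p ^ 2))) ∧
      (∀ (f : ZMod p → Fin p) (hf : CycleSet.IsTwist p f),
        ¬ (CycleSet.twisted p f hf).Isomorphic (CycleSet.square p)) ∧
      ¬ (CycleSet.square p).Isomorphic (CycleSet.shift (p ^ 2)) ∧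
      (∀ (f g : ZMod p → Fin p) (hf : CycleSet.IsTwist p f) (hg : CycleSet.IsTwist p g),
        (CycleSet.twisted p f hf).Isomorphic (CycleSet.twisted p g hg) → f = g) ∧
      -- the functions `f`, and the numbers of isomorphism classes
      (∀ f : ZMod p → Fin p, CycleSet.IsTwist p f ↔
        ∃ t : ZMod p, t ≠ 0 ∧ ∀ k, (f k : ℕ) = (k * t).val) ∧
      Nat.card {f : ZMod p → Fin p // CycleSet.IsTwist p f} = p - 1 ∧
      CycleSet.numIsoClasses (p ^ 2) = p + 1) := by
  refine ⟨fun hpq => ?_, fun _ => ?_⟩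
  · have h := CycleSet.shift_properties (p * q)
    exact ⟨h.1, h.2, fun _ _ hS => hS.isomorphic_shift hp hq hpq,
      CycleSet.numIsoClasses_mul hp hq hpq⟩
  · exact ⟨CycleSet.shift_properties _, CycleSet.twisted_properties, CycleSet.square_properties p,
      fun _ _ hS => hS.isomorphic_of_prime_sq hp,
      fun _ hf => CycleSet.not_isomorphic_twisted_shift hp hf,
      fun _ hf => CycleSet.not_isomorphic_twisted_square hp hf,
      CycleSet.not_isomorphic_square_shift hp,
      fun _ _ hf hg => CycleSet.eq_of_isomorphic_twisted hp hf hg,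
      CycleSet.isTwist_iff hp, CycleSet.card_isTwist hp, CycleSet.numIsoClasses_sq hp⟩
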